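/- Let $(G,\epsilon,x)$ be an augmented group system: $G$ is a finitely presented group, $\epsilon\colon G\to\langle t\mid\ \rangle\cong\mathbb Z$ is an epimorphism, and $x\in G$ satisfies $\epsilon(x)=t$. Put $K=\ker\epsilon$ and $\mu(u)=xux^{-1}$ for $u\in K$. Let $\rho\colon K\to S_N$ be a homomorphism, where $S_N$ acts on $[1,N]=\{1,\dots,N\}$ from the right and $iu$ denotes $i\rho(u)$. Assume that $K$ acts transitively on $[1,N]$ via $\rho$ and that $\rho$ is periodic with period $r\ge 1$ (not necessarily the least one), that is, $\rho\circ\mu^r=\rho$. The Crowell group $K_\rho$ is the group with generators ${}^iu$ ($1\le i\le N$, $u\in K$) and relations ${}^i(uv)=({}^iu)({}^{iu}v)$ ($u,v\in K$, $1\le i\le N$). Its abelianization $K_\rho^{\rm ab}$ is a $\mathbb Z[s^{\pm1}]$-module via $s\,{}^iu={}^i(\mu^r(u))$. The Alexander-Lin polynomial $D_{\rho,r}(s)\in\mathbb Z[s^{\pm1}]$, defined up to units, is the order of this module, i.e. the greatest common divisor of the maximal minors (minors of size the number of generators) of a finite presentation matrix with columns corresponding to generators and rows to relations. Let $G=\langle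 B,x\mid xax^{-1}=\phi(a)\ (\forall a\in U)\rangle$ be an HNN decomposition of $G$, where $B$ is a finitely generated subgroup of $K$, $U$ and $V$ are finitely generated subgroups of $B$, and $\phi\colon U\to V$ is an isomorphism. Put $U_\nu=x^\nu Ux^{-\nu}\le K$. If for some $\nu\in\{1,\dots,r-1\}$ the subgroup $U_\nu$ does not act transitively on $[1,N]$ via $\rho$, then $D_{\rho,r}(s)=0$. -/

import Mathlib

open scoped LaurentPolynomial

/-- An augmented group system `(G, ε, x)`: a finitely presented group `G`, an epimorphism `ε` onto
the infinite cyclic group `⟨t | ⟩` (written `Multiplicative ℤ`), and `x ∈ G` with `ε x = t`. -/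
structure AugmentedGroupSystem (G : Type*) [Group G] where
  finitelyPresented : Group.IsFinitelyPresented G
  ε : G →* Multiplicative ℤ
  ε_surjective : Function.Surjective ε
  x : G
  ε_x : ε x = Multiplicative.ofAdd 1

/-- The symmetric group on `N` symbols, acting on the right: the product `g * h` is
"first `g`, then `h`". -/
abbrev RightPerm (N : ℕ) : Type := (Equiv.Perm (Fin N))ᵐᵒᵖ

/-- The right action `i · g` of a permutation. -/
def RightPerm.act {N : ℕ} (i : Fin N) (g : RightPerm N) : Fin N := g.unop i

theorem RightPerm.act_mul {N : ℕ} (i : Fin N) (g h : RightPerm N) :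
    RightPerm.act i (g * h) = RightPerm.act (RightPerm.act i g) h := rfl

/-- A subgroup `H` of `K` acts transitively on the `N` symbols via `ρ : K → S_N`. -/
def ActsTransitively {K : Type*} [Group K] {N : ℕ} (ρ : K →* RightPerm N) (H : Subgroup K) :
    Prop :=
  ∀ i j : Fin N, ∃ u ∈ H, RightPerm.act i (ρ u) = j

section Crowell

variable {K : Type*} [Group K] {N : ℕ}

/-- The relators `ⁱ(uv) = (ⁱu)(ⁱᵘv)` of the Crowell group. -/
def crowellRels (ρ : K →* RightPerm N) : Set (FreeGroup (Fin N × K)) :=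
  {w | ∃ (i : Fin N) (u v : K),
    w = FreeGroup.of (i, u * v) *
      (FreeGroup.of (i, u) * FreeGroup.of (RightPerm.act i (ρ u), v))⁻¹}

/-- The Crowell group `K_ρ`: generators `ⁱu` (`1 ≤ i ≤ N`, `u ∈ K`), relations
`ⁱ(uv) = (ⁱu)(ⁱᵘv)`. -/
abbrev CrowellGroup (ρ : K →* RightPerm N) : Type _ := PresentedGroup (crowellRels ρ)

/-- The element `ⁱu` of the Crowell group. -/
def CrowellGroup.elt (ρ : K →* RightPerm N) (i : Fin N) (u : K) : CrowellGroup ρ :=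
  PresentedGroup.of (i, u)

theorem CrowellGroup.elt_mul (ρ : K →* RightPerm N) (i : Fin N) (u v : K) :
    CrowellGroup.elt ρ i (u * v) =
      CrowellGroup.elt ρ i u * CrowellGroup.elt ρ (RightPerm.act i (ρ u)) v :=
  PresentedGroup.mk_eq_mk_of_mul_inv_mem ⟨i, u, v, rfl⟩

/-- An automorphism `α` of `K` with `ρ ∘ α = ρ` induces the endomorphism `ⁱu ↦ ⁱ(α u)`. -/
def CrowellGroup.map (ρ : K →* RightPerm N) (α : MulAut K) (h : ∀ u, ρ (α u) = ρ u) :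
    CrowellGroup ρ →* CrowellGroup ρ :=
  PresentedGroup.toGroup (f := fun p : Fin N × K => CrowellGroup.elt ρ p.1 (α p.2)) (by
    rintro _ ⟨i, u, v, rfl⟩
    simp [map_mul, CrowellGroup.elt_mul, h])

theorem CrowellGroup.map_elt (ρ : K →* RightPerm N) (α : MulAut K) (h : ∀ u, ρ (α u) = ρ u)
    (i : Fin N) (u : K) :
    CrowellGroup.map ρ α h (CrowellGroup.elt ρ i u) = CrowellGroup.elt ρ i (α u) :=
  PresentedGroup.toGroup.of _

/-- An automorphism `α` of `K` with `ρ ∘ α = ρ` induces the automorphism `ⁱu ↦ ⁱ(α u)`. -/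
def CrowellGroup.congr (ρ : K →* RightPerm N) (α : MulAut K) (h : ∀ u, ρ (α u) = ρ u) :
    CrowellGroup ρ ≃* CrowellGroup ρ :=
  have h' : ∀ u, ρ (α⁻¹ u) = ρ u := fun u => by rw [← h (α⁻¹ u), MulAut.apply_inv_self]
  MonoidHom.toMulEquiv (CrowellGroup.map ρ α h) (CrowellGroup.map ρ α⁻¹ h')
    (PresentedGroup.ext fun p => by
      change CrowellGroup.map ρ α⁻¹ h' (CrowellGroup.map ρ α h (CrowellGroup.elt ρ p.1 p.2)) =
        CrowellGroup.elt ρ p.1 p.2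
      rw [CrowellGroup.map_elt, CrowellGroup.map_elt, MulAut.inv_apply_self])
    (PresentedGroup.ext fun p => by
      change CrowellGroup.map ρ α h (CrowellGroup.map ρ α⁻¹ h' (CrowellGroup.elt ρ p.1 p.2)) =
        CrowellGroup.elt ρ p.1 p.2
      rw [CrowellGroup.map_elt, CrowellGroup.map_elt, MulAut.apply_inv_self])

end Crowell

/-- The `ℤ[s, s⁻¹]`-module structure on an abelian group in which `s` acts as the
automorphism `e`. -/
noncomputable abbrev laurentModule {M : Type*} [AddCommGroup M] (e : M ≃+ M) :
    Module ℤ[T;T⁻¹] M :=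
  Module.compHom M
    (AddMonoidAlgebra.lift ℤ (AddMonoid.End M) ℤ
      ((Units.coeHom (AddMonoid.End M)).comp
        (zpowersHom (AddMonoid.End M)ˣ
          { val := e.toAddMonoidHom
            inv := e.symm.toAddMonoidHom
            val_inv := by ext m; exact e.apply_symm_apply m
            inv_val := by ext m; exact e.symm_apply_apply m }))).toRingHom

namespace AugmentedGroupSystem

variable {G : Type*} [Group G] (S : AugmentedGroupSystem G) {N : ℕ}

/-- The kernel `K` of `ε`. -/
abbrev K : Subgroup G := S.ε.ker

/-- The automorphism `u ↦ x u x⁻¹` of `K`. -/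
def μ : MulAut S.K := MulAut.conjNormal S.x

/-- The shift `σ ρ = ρ ∘ μ` on `Hom(K, S_N)`. -/
def shift (ρ : S.K →* RightPerm N) : S.K →* RightPerm N := ρ.comp S.μ.toMonoidHom

/-- `ρ` is periodic with (not necessarily least) period `r`: `r ≥ 1` and `σ^r ρ = ρ`. -/
def HasPeriod (ρ : S.K →* RightPerm N) (r : ℕ) : Prop := 0 < r ∧ S.shift^[r] ρ = ρ

variable {S} in
theorem HasPeriod.map_eq {ρ : S.K →* RightPerm N} {r : ℕ} (h : S.HasPeriod ρ r) (u : S.K) :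
    ρ ((S.μ ^ r) u) = ρ u := by
  have key : ∀ (n : ℕ) (τ : S.K →* RightPerm N) (u : S.K),
      (S.shift^[n] τ) u = τ ((S.μ ^ n) u) := by
    intro n
    induction n with
    | zero => intro τ u; simp
    | succ n ih =>
      intro τ u
      rw [Function.iterate_succ_apply, ih, pow_succ']
      rfl
  rw [← key r ρ u, h.2]

/-- The abelianization of the Crowell group `K_ρ` of a representation of period `r`, written
additively; the period is recorded because the module structure depends on it. -/
def AlexanderModule (ρ : S.K →* RightPerm N) (r : ℕ) (_h : S.HasPeriod ρ r) : Type _ :=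
  Additive (Abelianization (CrowellGroup ρ))

namespace AlexanderModule

variable {S} {ρ : S.K →* RightPerm N} {r : ℕ} (h : S.HasPeriod ρ r)

noncomputable instance : AddCommGroup (S.AlexanderModule ρ r h) :=
  inferInstanceAs (AddCommGroup (Additive (Abelianization (CrowellGroup ρ))))

/-- The automorphism `ⁱu ↦ ⁱ(μ^r u)` of the abelianized Crowell group. -/
noncomputable def sAut : S.AlexanderModule ρ r h ≃+ S.AlexanderModule ρ r h :=
  MulEquiv.toAdditive (CrowellGroup.congr ρ (S.μ ^ r) h.map_eq).abelianizationCongr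

/-- The `ℤ[s, s⁻¹]`-module structure with `s · ⁱu = ⁱ(μ^r u)`. -/
noncomputable instance : Module ℤ[T;T⁻¹] (S.AlexanderModule ρ r h) := laurentModule (sAut h)

/-- The class of `ⁱu`. -/
def elt (i : Fin N) (u : S.K) : S.AlexanderModule ρ r h :=
  Additive.ofMul (Abelianization.of (CrowellGroup.elt ρ i u))

theorem T_one_smul (m : S.AlexanderModule ρ r h) :
    (LaurentPolynomial.T 1 : ℤ[T;T⁻¹]) • m = sAut h m := by
  change (AddMonoidAlgebra.lift ℤ (AddMonoid.End (S.AlexanderModule ρ r h)) ℤ _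
    (AddMonoidAlgebra.single (1 : ℤ) (1 : ℤ))) m = _
  rw [AddMonoidAlgebra.lift_single, one_smul]
  simp
  rfl

theorem T_one_smul_elt (i : Fin N) (u : S.K) :
    (LaurentPolynomial.T 1 : ℤ[T;T⁻¹]) • elt h i u = elt h i ((S.μ ^ r) u) := by
  rw [T_one_smul]
  rfl

end AlexanderModule

end AugmentedGroupSystem

/-- `A` is a presentation matrix of the module `M`: its columns correspond to generators and its
rows generate all the relations between them. -/
def IsPresentationMatrix {R : Type*} [CommRing R] (M : Type*) [AddCommGroup M] [Module R M]
    {m n : ℕ} (A : Matrix (Fin m) (Fin n) R) : Prop :=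
  ∃ π : (Fin n → R) →ₗ[R] M,
    Function.Surjective π ∧ LinearMap.ker π = Submodule.span R (Set.range fun i => A i)

/-- `Δ` is the order `Δ₀ M` of `M` (defined up to units): a greatest common divisor of the maximal
minors (of size the number of generators) of a presentation matrix of `M`. When there are fewer
rows than columns all these minors vanish: every choice of rows repeats one. -/
def IsModuleOrder {R : Type*} [CommRing R] (M : Type*) [AddCommGroup M] [Module R M] (Δ : R) :
    Prop :=
  ∃ (m n : ℕ) (A : Matrix (Fin m) (Fin n) R), IsPresentationMatrix M A ∧
    ∀ d : R, d ∣ Δ ↔ ∀ f : Fin n → Fin m, d ∣ (A.submatrix f id).det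

namespace AugmentedGroupSystem

variable {G : Type*} [Group G] (S : AugmentedGroupSystem G) {N : ℕ}

/-- `D` is the Alexander–Lin polynomial `D_{ρ,r}(s) ∈ ℤ[s, s⁻¹]` (defined up to units): the order
of the `ℤ[s, s⁻¹]`-module `K_ρ^ab`. -/
def IsAlexanderLinPolynomial (ρ : S.K →* RightPerm N) (r : ℕ) (h : S.HasPeriod ρ r)
    (D : ℤ[T;T⁻¹]) : Prop :=
  IsModuleOrder (S.AlexanderModule ρ r h) D

/-- An HNN decomposition `G = ⟨B, x ∣ x a x⁻¹ = φ a (a ∈ U)⟩` with finitely generated base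
`B ≤ K`, finitely generated subgroups `U, V ≤ B` and an isomorphism `φ : U ≃ V`: the relations
hold in `G`, and the canonical map from the abstract HNN extension to `G` is bijective. -/
structure HNNDecomposition where
  B : Subgroup G
  B_le : B ≤ S.K
  B_fg : B.FG
  U : Subgroup B
  V : Subgroup B
  U_fg : U.FG
  V_fg : V.FG
  φ : U ≃* V
  conj_eq : ∀ a : U, S.x * B.subtype a = B.subtype (φ a) * S.x
  bijective : Function.Bijective (HNNExtension.lift (φ := φ) B.subtype S.x conj_eq)

/-- The subgroup `U_ν = x^ν U x^{-ν}` of `K`. -/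
def HNNDecomposition.Uν {S : AugmentedGroupSystem G} (H : S.HNNDecomposition) (ν : ℤ) :
    Subgroup S.K :=
  ((H.U.map H.B.subtype).map (MulAut.conj (S.x ^ ν)).toMonoidHom).subgroupOf S.K

end AugmentedGroupSystem

/-! A finitely generated module over the Noetherian domain `ℤ[T;T⁻¹]` that carries a nonzero linear
form has order zero, because every maximal minor annihilates it. It therefore suffices to show that
the Alexander module is finitely generated (`AlexanderModule.finite`) and to construct such a form
(`exists_linearMap_ne_zero`).

A linear form amounts to a crossed homomorphism on `K` on which `μ^r` acts as multiplication by `s`.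
Let `G` act on functions on `ℤ × [1,N]` through the action induced by `ρ`, so that `u ∈ K` acts on
level `m` by `ρ (μ^m u)`. Intransitivity of `U_ν` gives a nonconstant `U_ν`-invariant function `g`
on `[1,N]`. Put `t(m,i) = s^⌊(m-ν)/r⌋ g(i)`, and prescribe `b ↦ t - b·t` on `B` and `x ↦ 0`. This
respects the HNN relations if each `φ(a)` fixes `t - x·t`. That function lives on the levels `m ≡ ν
- 1` mod `r`, where `φ(a) = xax⁻¹` acts as an element of `U_ν` and so preserves `g`.

The value at level 0 of the resulting crossed homomorphism gives the form. Were it zero, `g` would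
be invariant under all `x^m B x^{-m}`, hence under `K`, contradicting transitivity. -/

/-! ### Modules of order zero -/

section Order

variable {R : Type*} [CommRing R] {M : Type*} [AddCommGroup M] [Module R M]

/-- A maximal minor of a presentation matrix annihilates the module. -/
theorem IsPresentationMatrix.exists_det_smul_eq_zero {m n : ℕ} {A : Matrix (Fin m) (Fin n) R}
    (hA : IsPresentationMatrix M A) (f : Fin n → Fin m) (y : M) :
    (A.submatrix f id).det • y = 0 := by
  obtain ⟨π, hπ, hker⟩ := hA
  obtain ⟨v, rfl⟩ := hπ y
  rw [← map_smul, ← LinearMap.mem_ker, hker]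
  -- By the adjugate identity, `det • v` is a combination of the selected rows, all of which are
  -- relations.
  have h : (A.submatrix f id).det • v =
      Matrix.vecMul (Matrix.vecMul v (A.submatrix f id).adjugate) (A.submatrix f id) := by
    rw [Matrix.vecMul_vecMul, Matrix.adjugate_mul, Matrix.vecMul_smul, Matrix.vecMul_one]
  rw [h, Matrix.vecMul_eq_sum]
  exact Submodule.sum_mem _ fun i _ =>
    Submodule.smul_mem _ _ (Submodule.subset_span ⟨f i, rfl⟩)

/-- A finitely generated module over a Noetherian ring has a presentation matrix. -/
theorem exists_isPresentationMatrix [IsNoetherianRing R] [Module.Finite R M] :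
    ∃ (m n : ℕ) (A : Matrix (Fin m) (Fin n) R), IsPresentationMatrix M A := by
  obtain ⟨n, π, hπ⟩ := Module.Finite.exists_fin' R M
  obtain ⟨m, A, hA⟩ := Submodule.fg_iff_exists_fin_generating_family.1
    (IsNoetherian.noetherian (LinearMap.ker π))
  exact ⟨m, n, A, π, hπ, hA.symm⟩

/-- A finitely generated module over a Noetherian domain with a nonzero linear form has
order zero. -/
theorem isModuleOrder_iff_eq_zero [IsDomain R] [IsNoetherianRing R] [Module.Finite R M]
    (F : M →ₗ[R] R) (hF : F ≠ 0) (D : R) : IsModuleOrder M D ↔ D = 0 := by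
  have minors : ∀ {m n : ℕ} {A : Matrix (Fin m) (Fin n) R}, IsPresentationMatrix M A →
      ∀ f : Fin n → Fin m, (A.submatrix f id).det = 0 := by
    intro m n A hA f
    obtain ⟨y, hy⟩ : ∃ y, F y ≠ 0 := by
      by_contra! h
      exact hF (LinearMap.ext h)
    have h := congrArg F (hA.exists_det_smul_eq_zero f y)
    rw [map_smul, map_zero, smul_eq_mul] at h
    exact (mul_eq_zero.1 h).resolve_right hy
  constructor
  · rintro ⟨m, n, A, hA, h⟩
    -- The divisor `d = 0` divides every minor, hence divides `D`.
    exact zero_dvd_iff.1 ((h 0).2 fun f => by rw [minors hA f])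
  · rintro rfl
    obtain ⟨m, n, A, hA⟩ := exists_isPresentationMatrix (R := R) (M := M)
    exact ⟨m, n, A, hA, fun d => ⟨fun _ f => by rw [minors hA f]; exact dvd_zero d,
      fun _ => dvd_zero d⟩⟩

end Order

/-! ### Laurent polynomials over the integers. -/

theorem LaurentPolynomial.isNoetherianRing_int : IsNoetherianRing ℤ[T;T⁻¹] :=
  have := LaurentPolynomial.isLocalization (R := ℤ)
  IsLocalization.isNoetherianRing (Submonoid.powers (Polynomial.X : Polynomial ℤ)) _ inferInstance

/-- An additive map commuting with `T` is linear over the Laurent polynomials. -/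
theorem LaurentPolynomial.map_smul_of_map_T_smul {M M' : Type*} [AddCommGroup M]
    [Module ℤ[T;T⁻¹] M] [AddCommGroup M'] [Module ℤ[T;T⁻¹] M'] (F : M →+ M')
    (h : ∀ y, F ((T 1 : ℤ[T;T⁻¹]) • y) = (T 1 : ℤ[T;T⁻¹]) • F y) (p : ℤ[T;T⁻¹]) (y : M) :
    F (p • y) = p • F y := by
  have hinv : ∀ y, F ((T (-1) : ℤ[T;T⁻¹]) • y) = (T (-1) : ℤ[T;T⁻¹]) • F y := by
    intro y
    have := h ((T (-1) : ℤ[T;T⁻¹]) • y)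
    rw [smul_smul, ← T_add] at this
    simp only [add_neg_cancel, T_zero, one_smul] at this
    rw [this, smul_smul, ← T_add]
    simp
  induction p using LaurentPolynomial.induction_on generalizing y with
  | h_C a =>
    have hC : (C a : ℤ[T;T⁻¹]) = (a : ℤ[T;T⁻¹]) := by simp
    rw [hC, Int.cast_smul_eq_zsmul, Int.cast_smul_eq_zsmul, map_zsmul]
  | h_add hp hq => rw [add_smul, map_add, hp, hq, add_smul]
  | h_C_mul_T n a ih => rw [T_add, ← mul_assoc, mul_smul, ih, h, ← mul_smul]
  | h_C_mul_T_Z n a ih => rw [sub_eq_add_neg, T_add, ← mul_assoc, mul_smul, ih, hinv, ← mul_smul]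

/-! ### Crossed homomorphisms on an HNN extension -/

section CrossedHom

variable {G W : Type*} [Group G] [AddCommGroup W]

theorem AddMonoid.End.map_mul_apply (L : G →* AddMonoid.End W) (g h : G) (w : W) :
    L (g * h) w = L g (L h w) := by
  rw [map_mul]; rfl

theorem AddMonoid.End.map_one_apply (L : G →* AddMonoid.End W) (w : W) : L 1 w = w := by
  rw [map_one]; rfl

/-- The permutation action underlying a linear action. -/
def linearPerm (L : G →* AddMonoid.End W) : G →* Equiv.Perm W where
  toFun g := ⟨L g, L g⁻¹, fun w => by
      rw [← AddMonoid.End.map_mul_apply, inv_mul_cancel, AddMonoid.End.map_one_apply],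
    fun w => by rw [← AddMonoid.End.map_mul_apply, mul_inv_cancel, AddMonoid.End.map_one_apply]⟩
  map_one' := by ext w; exact AddMonoid.End.map_one_apply L w
  map_mul' g h := by ext w; exact AddMonoid.End.map_mul_apply L g h w

end CrossedHom

namespace AugmentedGroupSystem

variable {G : Type*} [Group G] {S : AugmentedGroupSystem G} {N : ℕ}

namespace HNNDecomposition

variable (H : S.HNNDecomposition)

/-- `G` is generated by the base and the stable letter. -/
theorem induction_on {p : G → Prop} (g : G) (base : ∀ b ∈ H.B, p b) (stable : p S.x)
    (mul : ∀ g h, p g → p h → p (g * h)) (inv : ∀ g, p g → p g⁻¹) : p g := by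
  obtain ⟨w, rfl⟩ := H.bijective.2 g
  induction w using HNNExtension.induction_on with
  | of b => simpa using base b b.2
  | t => simpa using stable
  | mul a b ha hb => rw [map_mul]; exact mul _ _ ha hb
  | inv a ha => rw [map_inv]; exact inv _ ha

/-- A principal crossed homomorphism on the base extends to a crossed homomorphism on `G` that
vanishes on the stable letter, as soon as it is compatible with the amalgamation. -/
theorem exists_crossedHom {W : Type*} [AddCommGroup W] (L : G →* AddMonoid.End W) (t : W)
    (ht : ∀ a : H.U, L (H.φ a : H.B) (t - L S.x t) = t - L S.x t) :
    ∃ c : G → W, (∀ g h, c (g * h) = c g + L g (c h)) ∧ (∀ b ∈ H.B, c b = t - L b t) ∧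
      c S.x = 0 := by
  -- Conjugating by translation moves the fixed point of the base from `0` to `t`, so `f b` sends
  -- `0` to `t - L b t`.
  let τ : Equiv.Perm W := Equiv.addRight t
  let f : H.B →* Equiv.Perm W :=
    (MulAut.conj τ).toMonoidHom.comp ((linearPerm L).comp H.B.subtype)
  have hf : ∀ (b : H.B) (w : W), f b w = L b (w - t) + t := by
    intro b w
    simp [f, τ, linearPerm, sub_eq_add_neg]
  -- Both sides are affine with the same linear part; `ht` says exactly that their translation parts
  -- agree.
  have hx : ∀ a : H.U, linearPerm L S.x * f a = f (H.φ a) * linearPerm L S.x := by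
    intro a
    ext w
    have h1 := H.conj_eq a
    have h2 := ht a
    have h3 : ∀ v, L S.x (L ((a : H.B) : G) v) = L ((H.φ a : H.B) : G) (L S.x v) := by
      intro v
      rw [← AddMonoid.End.map_mul_apply, ← AddMonoid.End.map_mul_apply]
      exact congrArg (fun g => L g v) h1
    have h4 : ∀ v, linearPerm L S.x v = L S.x v := fun _ => rfl
    simp only [Equiv.Perm.mul_apply, h4, hf, map_add, map_sub, h3] at h2 ⊢
    rw [sub_eq_sub_iff_add_eq_add] at h2
    rw [sub_add, sub_add, ← neg_inj]
    have h5 : L ((H.φ a : H.B) : G) (L S.x t) - L S.x t = L ((H.φ a : H.B) : G) t - t := by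
      rw [sub_eq_sub_iff_add_eq_add, add_comm, ← h2, add_comm]
    rw [h5]
  let e := MulEquiv.ofBijective _ H.bijective
  let ψ : G →* Equiv.Perm W :=
    (HNNExtension.lift f (linearPerm L S.x) hx).comp e.symm.toMonoidHom
  have hψB : ∀ b : H.B, ψ b = f b := by
    intro b
    have : e.symm (b : G) = HNNExtension.of b := by
      rw [MulEquiv.symm_apply_eq]; simp [e]
    simp [ψ, this]
  have hψx : ψ S.x = linearPerm L S.x := by
    have : e.symm S.x = HNNExtension.t := by
      rw [MulEquiv.symm_apply_eq]; simp [e]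
    simp [ψ, this]
  -- All of `G` acts by affine maps with linear part `L`, so the translation part `ψ g 0` is a
  -- crossed homomorphism.
  have haff : ∀ g w, ψ g w = ψ g 0 + L g w := by
    intro g
    refine H.induction_on (p := fun g => ∀ w, ψ g w = ψ g 0 + L g w) g ?_ ?_ ?_ ?_
    · intro b hb w
      rw [hψB ⟨b, hb⟩, hf, hf]
      simp only [map_sub, map_zero]
      abel
    · intro w
      rw [hψx]
      simp [linearPerm]
    · intro g h hg hh w
      rw [map_mul, Equiv.Perm.mul_apply, Equiv.Perm.mul_apply, hh w, hg, hg (ψ h 0),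
        AddMonoid.End.map_mul_apply, map_add, add_assoc]
    · intro g hg w
      rw [map_inv, Equiv.Perm.inv_eq_iff_eq, hg]
      have h0 : 0 = ψ g 0 + L g ((ψ g)⁻¹ 0) := by
        rw [← hg, ← Equiv.Perm.mul_apply, mul_inv_cancel, Equiv.Perm.one_apply]
      rw [map_add, ← add_assoc, ← h0, zero_add, ← AddMonoid.End.map_mul_apply, mul_inv_cancel,
        AddMonoid.End.map_one_apply]
  refine ⟨fun g => ψ g 0, fun g h => ?_, fun b hb => ?_, ?_⟩
  · change ψ (g * h) 0 = _
    rw [map_mul, Equiv.Perm.mul_apply, haff]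
  · change ψ b 0 = _
    rw [hψB ⟨b, hb⟩, hf]
    simp only [map_sub, map_zero]
    abel
  · change ψ S.x 0 = _
    rw [hψx]
    simp [linearPerm]

end HNNDecomposition

end AugmentedGroupSystem

namespace AugmentedGroupSystem

variable {G : Type*} [Group G] {S : AugmentedGroupSystem G} {N : ℕ}

/-! ### The degree and the kernel -/

variable (S) in
/-- The exponent of `ε g`. -/
def deg (g : G) : ℤ := Multiplicative.toAdd (S.ε g)

theorem deg_mul (g h : G) : S.deg (g * h) = S.deg g + S.deg h := by simp [deg]

theorem deg_x_zpow (k : ℤ) : S.deg (S.x ^ k) = k := by simp [deg, S.ε_x]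

theorem deg_x : S.deg S.x = 1 := by simp [deg, S.ε_x]

theorem mem_K_iff {g : G} : g ∈ S.K ↔ S.deg g = 0 := by
  rw [MonoidHom.mem_ker]; rfl

theorem coe_μ_zpow (k : ℤ) (u : S.K) : ((S.μ ^ k) u : G) = S.x ^ k * u * S.x ^ (-k) := by
  rw [μ, ← map_zpow, MulAut.conjNormal_apply, zpow_neg]

variable (S) in
/-- The element `x^m g x^{-(m + deg g)}` of `K`. -/
def twist (m : ℤ) (g : G) : S.K :=
  ⟨S.x ^ m * g * S.x ^ (-(m + S.deg g)), by
    rw [mem_K_iff]; simp only [deg_mul, deg_x_zpow]; ring⟩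

/-- The powers of `x` between the two factors cancel. This cocycle identity makes `inducedAction` an
action. -/
theorem twist_mul (m : ℤ) (g h : G) :
    S.twist m (g * h) = S.twist m g * S.twist (m + S.deg g) h := by
  ext
  simp only [twist, deg_mul, Subgroup.coe_mul, zpow_neg]
  group

theorem twist_one (m : ℤ) : S.twist m 1 = 1 := by
  ext
  simp [twist, deg]

theorem twist_x (m : ℤ) : S.twist m S.x = 1 := by
  ext
  simp only [twist, deg_x, zpow_neg, Subgroup.coe_one]
  group

theorem twist_coe (m : ℤ) (u : S.K) : S.twist m u = (S.μ ^ m) u := by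
  ext
  simp only [coe_μ_zpow, twist, mem_K_iff.1 u.2, add_zero]

/-- With `k = r` and the period of `ρ`, this makes the induced action commute with the shift `m ↦ m
+ r`. -/
theorem twist_add (k m : ℤ) (g : G) : S.twist (m + k) g = (S.μ ^ k) (S.twist m g) := by
  ext
  simp only [coe_μ_zpow, twist, zpow_neg]
  group

theorem HasPeriod.map_zpow_eq {ρ : S.K →* RightPerm N} {r : ℕ} (h : S.HasPeriod ρ r) (k : ℤ)
    (u : S.K) : ρ ((S.μ ^ ((r : ℤ) * k)) u) = ρ u := by
  rw [zpow_mul, zpow_natCast]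
  induction k using Int.induction_on generalizing u with
  | zero => simp
  | succ n ih => rw [zpow_add_one, MulAut.mul_apply, ih, h.map_eq]
  | pred n ih =>
    rw [zpow_sub_one, MulAut.mul_apply, ih, ← h.map_eq, MulAut.apply_inv_self]

/-! ### The induced action on functions on `ℤ × [1,N]`. -/

/-- The right action of `G` on `ℤ × [1, N]` induced by `ρ`, acting on functions. -/
def inducedAction {A : Type*} [AddCommGroup A] (ρ : S.K →* RightPerm N) :
    G →* AddMonoid.End (ℤ → Fin N → A) where
  toFun g :=
    { toFun := fun F m i => F (m + S.deg g) (RightPerm.act i (ρ (S.twist m g)))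
      map_zero' := rfl
      map_add' := fun _ _ => rfl }
  map_one' := by
    ext F m i
    change F (m + S.deg 1) (RightPerm.act i (ρ (S.twist m 1))) = F m i
    rw [twist_one, map_one]
    simp [deg, RightPerm.act]
  map_mul' g h := by
    ext F m i
    change F (m + S.deg (g * h)) (RightPerm.act i (ρ (S.twist m (g * h)))) =
      F (m + S.deg g + S.deg h)
        (RightPerm.act (RightPerm.act i (ρ (S.twist m g))) (ρ (S.twist (m + S.deg g) h)))
    rw [twist_mul, map_mul, RightPerm.act_mul, deg_mul, add_assoc]

theorem inducedAction_apply {A : Type*} [AddCommGroup A] (ρ : S.K →* RightPerm N) (g : G)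
    (F : ℤ → Fin N → A) (m : ℤ) (i : Fin N) :
    inducedAction ρ g F m i = F (m + S.deg g) (RightPerm.act i (ρ (S.twist m g))) := rfl

theorem inducedAction_coe {A : Type*} [AddCommGroup A] (ρ : S.K →* RightPerm N) (u : S.K)
    (F : ℤ → Fin N → A) (m : ℤ) (i : Fin N) :
    inducedAction ρ (u : G) F m i = F m (RightPerm.act i (ρ ((S.μ ^ m) u))) := by
  rw [inducedAction_apply, mem_K_iff.1 u.2, add_zero, twist_coe]

theorem inducedAction_x {A : Type*} [AddCommGroup A] (ρ : S.K →* RightPerm N)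
    (F : ℤ → Fin N → A) (m : ℤ) (i : Fin N) : inducedAction ρ S.x F m i = F (m + 1) i := by
  rw [inducedAction_apply, deg_x, twist_x, map_one]
  rfl

/-- An intransitive subgroup admits a nonconstant invariant function. -/
theorem exists_invariant_of_not_actsTransitively {K : Type*} [Group K] (ρ : K →* RightPerm N)
    {J : Subgroup K} (h : ¬ ActsTransitively ρ J) (A : Type*) [Zero A] [One A] [NeZero (1 : A)] :
    ∃ g : Fin N → A, (∀ u ∈ J, ∀ i, g (RightPerm.act i (ρ u)) = g i) ∧ ∃ i j, g i ≠ g j := by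
  classical
  unfold ActsTransitively at h
  push Not at h
  obtain ⟨i, j, hij⟩ := h
  -- The indicator function of the `J`-orbit of `i`, which misses `j`.
  refine ⟨fun k => if ∃ u ∈ J, RightPerm.act i (ρ u) = k then 1 else 0, fun u hu k => ?_,
    i, j, ?_⟩
  · refine if_congr ⟨?_, ?_⟩ rfl rfl
    · rintro ⟨v, hv, hvk⟩
      refine ⟨v * u⁻¹, J.mul_mem hv (J.inv_mem hu), ?_⟩
      rw [map_mul, RightPerm.act_mul, hvk, ← RightPerm.act_mul, ← map_mul, mul_inv_cancel, map_one]
      rfl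
    · rintro ⟨v, hv, rfl⟩
      exact ⟨v * u, J.mul_mem hv hu, by rw [map_mul, RightPerm.act_mul]⟩
  · have h1 : ∃ u ∈ J, RightPerm.act i (ρ u) = i := ⟨1, J.one_mem, by rw [map_one]; rfl⟩
    have h2 : ¬ ∃ u ∈ J, RightPerm.act i (ρ u) = j := by
      rintro ⟨u, hu, h⟩
      exact hij u hu h
    simp [h1, h2]

/-! ### The Alexander module -/

namespace AlexanderModule

variable {ρ : S.K →* RightPerm N} {r : ℕ} (h : S.HasPeriod ρ r)

theorem elt_mul (i : Fin N) (u v : S.K) :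
    elt h i (u * v) = elt h i u + elt h (RightPerm.act i (ρ u)) v := by
  unfold elt
  rw [CrowellGroup.elt_mul, map_mul]
  rfl

theorem elt_one (i : Fin N) : elt h i 1 = 0 := by
  have := elt_mul h i 1 1
  rw [mul_one, map_one] at this
  exact left_eq_add.1 this

theorem closure_elt : AddSubgroup.closure
    (Set.range fun p : Fin N × S.K => elt h p.1 p.2) = ⊤ := by
  rw [eq_top_iff]
  intro y _
  obtain ⟨w, rfl⟩ : ∃ w : CrowellGroup ρ, Additive.ofMul (Abelianization.of w) = y :=
    QuotientGroup.mk_surjective (Additive.toMul y)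
  have hw : w ∈ Subgroup.closure (Set.range (PresentedGroup.of (rels := crowellRels ρ))) := by
    rw [PresentedGroup.closure_range_of]; trivial
  induction hw using Subgroup.closure_induction with
  | mem w hw =>
    obtain ⟨p, rfl⟩ := hw
    exact AddSubgroup.subset_closure ⟨p, rfl⟩
  | one => rw [map_one]; exact AddSubgroup.zero_mem _
  | mul a b _ _ ha hb => rw [map_mul]; exact AddSubgroup.add_mem _ (ha trivial) (hb trivial)
  | inv a _ ha => rw [map_inv]; exact AddSubgroup.neg_mem _ (ha trivial)

/-- A crossed homomorphism on `K` induces a homomorphism on the Alexander module. -/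
theorem exists_addMonoidHom {A : Type*} [AddCommGroup A] (f : Fin N → S.K → A)
    (hf : ∀ i u v, f i (u * v) = f i u + f (RightPerm.act i (ρ u)) v) :
    ∃ F : S.AlexanderModule ρ r h →+ A, ∀ i u, F (elt h i u) = f i u := by
  let F₀ : CrowellGroup ρ →* Multiplicative A :=
    PresentedGroup.toGroup (f := fun p : Fin N × S.K => Multiplicative.ofAdd (f p.1 p.2)) (by
      rintro _ ⟨i, u, v, rfl⟩
      simp [hf])
  refine ⟨MonoidHom.toAdditiveLeft (Abelianization.lift F₀), fun i u => ?_⟩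
  change Multiplicative.toAdd (Abelianization.lift F₀ (Abelianization.of
    (CrowellGroup.elt ρ i u))) = f i u
  rw [Abelianization.lift_apply_of]
  exact congrArg Multiplicative.toAdd (PresentedGroup.toGroup.of _)

/-- A crossed homomorphism on `K` equivariant under the period induces a linear form. -/
theorem exists_linearMap (f : Fin N → S.K → ℤ[T;T⁻¹])
    (hf : ∀ i u v, f i (u * v) = f i u + f (RightPerm.act i (ρ u)) v)
    (hs : ∀ i u, f i ((S.μ ^ r) u) = LaurentPolynomial.T 1 * f i u) :
    ∃ F : S.AlexanderModule ρ r h →ₗ[ℤ[T;T⁻¹]] ℤ[T;T⁻¹], ∀ i u, F (elt h i u) = f i u := by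
  obtain ⟨F, hF⟩ := exists_addMonoidHom h f hf
  have hT : ∀ y, F ((LaurentPolynomial.T 1 : ℤ[T;T⁻¹]) • y) =
      (LaurentPolynomial.T 1 : ℤ[T;T⁻¹]) • F y := by
    intro y
    have hy : y ∈ AddSubgroup.closure (Set.range fun p : Fin N × S.K => elt h p.1 p.2) := by
      rw [closure_elt]; trivial
    induction hy using AddSubgroup.closure_induction with
    | mem y hy =>
      obtain ⟨⟨i, u⟩, rfl⟩ := hy
      rw [T_one_smul_elt, hF, hF, hs, smul_eq_mul]
    | zero => simp
    | add a b _ _ ha hb => rw [smul_add, map_add, ha, hb, map_add, smul_add]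
    | neg a _ ha => rw [smul_neg, map_neg, ha, map_neg, smul_neg]
  exact ⟨{ F with map_smul' := LaurentPolynomial.map_smul_of_map_T_smul F hT }, hF⟩

end AlexanderModule

end AugmentedGroupSystem

/-! ### Generation of the kernel by conjugates of the base. -/

namespace AugmentedGroupSystem

variable {G : Type*} [Group G] {S : AugmentedGroupSystem G} {N : ℕ}

namespace HNNDecomposition

variable (H : S.HNNDecomposition)

/-- The kernel `K` is generated by the conjugates of the base by powers of `x`. -/
theorem mem_of_conj_mem {J : Subgroup S.K}
    (hJ : ∀ (m : ℤ) (b : S.K), (b : G) ∈ H.B → (S.μ ^ m) b ∈ J) (u : S.K) : u ∈ J := by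
  have key : ∀ g : G, ∀ m, S.twist m g ∈ J := by
    intro g
    refine H.induction_on (p := fun g => ∀ m, S.twist m g ∈ J) g ?_ ?_ ?_ ?_
    · intro b hb m
      have := hJ m ⟨b, H.B_le hb⟩ hb
      rwa [← twist_coe] at this
    · intro m
      rw [twist_x]
      exact J.one_mem
    · intro g h hg hh m
      rw [twist_mul]
      exact J.mul_mem (hg _) (hh _)
    · intro g hg m
      have h1 : S.twist m g⁻¹ * S.twist (m + S.deg g⁻¹) g = 1 := by
        rw [← twist_mul, inv_mul_cancel, twist_one]
      rw [eq_inv_of_mul_eq_one_left h1]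
      exact J.inv_mem (hg _)
  have := key u 0
  rwa [twist_coe, zpow_zero] at this

end HNNDecomposition

/-! ### Finite generation of the Alexander module -/

namespace AlexanderModule

variable {ρ : S.K →* RightPerm N} {r : ℕ} (h : S.HasPeriod ρ r)

theorem T_smul_elt (k : ℤ) (i : Fin N) (u : S.K) :
    (LaurentPolynomial.T k : ℤ[T;T⁻¹]) • elt h i u = elt h i ((S.μ ^ ((r : ℤ) * k)) u) := by
  rw [zpow_mul, zpow_natCast]
  induction k using Int.induction_on generalizing u with
  | zero => simp
  | succ n ih =>
    rw [LaurentPolynomial.T_add, mul_smul, T_one_smul_elt, ih, zpow_add_one, MulAut.mul_apply]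
  | pred n ih =>
    have h1 : (LaurentPolynomial.T (-1) : ℤ[T;T⁻¹]) • elt h i u = elt h i ((S.μ ^ r)⁻¹ u) := by
      have h2 := T_one_smul_elt h i ((S.μ ^ r)⁻¹ u)
      rw [MulAut.apply_inv_self] at h2
      rw [← h2, smul_smul, ← LaurentPolynomial.T_add]
      simp
    rw [sub_eq_add_neg, LaurentPolynomial.T_add, mul_smul, h1, ih, ← sub_eq_add_neg,
      zpow_sub_one, MulAut.mul_apply]

/-- The elements of `K` all of whose classes lie in a given submodule. -/
def eltSubgroup (Q : Submodule ℤ[T;T⁻¹] (S.AlexanderModule ρ r h)) : Subgroup S.K where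
  carrier := {u | ∀ i, elt h i u ∈ Q}
  one_mem' i := by rw [elt_one]; exact Q.zero_mem
  mul_mem' hu hv i := by rw [elt_mul]; exact Q.add_mem (hu _) (hv _)
  inv_mem' {u} hu i := by
    have h1 := elt_mul h (RightPerm.act i (ρ u⁻¹)) u u⁻¹
    have h2 : RightPerm.act (RightPerm.act i (ρ u⁻¹)) (ρ u) = i := by
      rw [← RightPerm.act_mul, ← map_mul, inv_mul_cancel, map_one]
      rfl
    rw [mul_inv_cancel, elt_one, h2] at h1
    rw [eq_neg_of_add_eq_zero_right h1.symm]
    exact Q.neg_mem (hu _)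

theorem eq_top_of_forall_elt_mem {Q : Submodule ℤ[T;T⁻¹] (S.AlexanderModule ρ r h)}
    (hQ : ∀ i u, elt h i u ∈ Q) : Q = ⊤ := by
  have h1 : AddSubgroup.closure (Set.range fun p : Fin N × S.K => elt h p.1 p.2) ≤
      Q.toAddSubgroup := by
    rw [AddSubgroup.closure_le]
    rintro _ ⟨p, rfl⟩
    exact hQ _ _
  rw [closure_elt] at h1
  exact eq_top_iff.2 fun y _ => h1 trivial

/-- If `G` has an HNN decomposition then the Alexander module is finitely generated. -/
theorem finite (H : S.HNNDecomposition) :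
    Module.Finite ℤ[T;T⁻¹] (S.AlexanderModule ρ r h) := by
  obtain ⟨X, hX⟩ := H.B_fg
  let Y : Set S.K := Subtype.val ⁻¹' (X : Set G)
  have hY : Y.Finite := X.finite_toSet.preimage Subtype.val_injective.injOn
  let E : Set (S.AlexanderModule ρ r h) :=
    (fun p : Fin N × ℕ × S.K => elt h p.1 ((S.μ ^ p.2.1) p.2.2)) ''
      (Set.univ ×ˢ Set.Iio r ×ˢ Y)
  have hE : E.Finite := (Set.finite_univ.prod ((Set.finite_Iio r).prod hY)).image _
  refine ⟨Submodule.fg_def.2 ⟨E, hE, eq_top_of_forall_elt_mem h fun i u => ?_⟩⟩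
  refine H.mem_of_conj_mem (J := eltSubgroup h (Submodule.span _ E)) (fun m b hb => ?_) u i
  have hle : H.B ≤ ((eltSubgroup h (Submodule.span _ E)).comap (S.μ ^ m).toMonoidHom).map
      S.K.subtype := by
    rw [← hX, Subgroup.closure_le]
    intro g hg
    have hgB : g ∈ H.B := hX ▸ Subgroup.subset_closure hg
    refine ⟨⟨g, H.B_le hgB⟩, fun j => ?_, rfl⟩
    have hr : (0 : ℤ) < r := by exact_mod_cast h.1
    obtain ⟨n, hn⟩ := Int.eq_ofNat_of_zero_le (Int.emod_nonneg m hr.ne')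
    have hlt : n < r := by
      have := Int.emod_lt_of_pos m hr
      omega
    -- The multiple of `r` in the exponent becomes a power of `s`, leaving finitely many remainders
    -- `n < r`.
    have hm : m = (r : ℤ) * (m / r) + (n : ℤ) := by
      rw [← hn]; exact (Int.mul_ediv_add_emod m r).symm
    change elt h j ((S.μ ^ m) ⟨g, H.B_le hgB⟩) ∈ _
    rw [hm, zpow_add, MulAut.mul_apply, ← T_smul_elt, zpow_natCast]
    exact Submodule.smul_mem _ _ (Submodule.subset_span
      ⟨(j, n, ⟨g, H.B_le hgB⟩), ⟨trivial, hlt, hg⟩, rfl⟩)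
  obtain ⟨b', hb', hbb⟩ := hle hb
  obtain rfl : b' = b := Subtype.ext hbb
  exact hb'

end AlexanderModule

/-! ### A nonzero linear form -/

/-- The coefficient `s^⌊(m - ν) / r⌋`. -/
noncomputable def weight (r : ℕ) (ν m : ℤ) : ℤ[T;T⁻¹] := LaurentPolynomial.T ((m - ν) / r)

theorem weight_add {r : ℕ} (hr : 0 < r) (ν m : ℤ) :
    weight r ν (m + r) = LaurentPolynomial.T 1 * weight r ν m := by
  have h : (m + r - ν) / (r : ℤ) = 1 + (m - ν) / r := by
    rw [show m + r - ν = (m - ν) + r by ring, Int.add_ediv_of_dvd_right (dvd_refl _),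
      Int.ediv_self (by omega), add_comm]
  rw [weight, h, LaurentPolynomial.T_add, weight]

theorem weight_ne_zero (r : ℕ) (ν m : ℤ) : weight r ν m ≠ 0 :=
  (LaurentPolynomial.isUnit_T _).ne_zero

/-- The floor `⌊(m-ν)/r⌋` jumps only on passing to a level congruent to `ν` mod `r`; this is what
confines the compatibility condition to `U_ν`. -/
theorem weight_succ {r : ℕ} (hr : 0 < r) {ν m : ℤ} (h : ¬ (r : ℤ) ∣ m + 1 - ν) :
    weight r ν (m + 1) = weight r ν m := by
  have hr' : (0 : ℤ) < r := by exact_mod_cast hr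
  unfold weight
  congr 1
  have e1 := Int.mul_ediv_add_emod (m + 1 - ν) r
  have h1 := Int.emod_nonneg (m + 1 - ν) hr'.ne'
  have h2 := Int.emod_lt_of_pos (m + 1 - ν) hr'
  have h3 : (m + 1 - ν) % r ≠ 0 := fun h0 => h (Int.dvd_of_emod_eq_zero h0)
  symm
  rw [Int.ediv_eq_iff_of_pos hr']
  constructor <;> linarith [show (m + 1 - ν) % r ≥ 1 by omega]

/-- An intransitive conjugate of the associated subgroup produces a nonzero linear form on the
Alexander module. -/
theorem HNNDecomposition.exists_linearMap_ne_zero (H : S.HNNDecomposition)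
    {ρ : S.K →* RightPerm N} (hK : ActsTransitively ρ ⊤) {r : ℕ} (h : S.HasPeriod ρ r) {ν : ℤ}
    (hν : ¬ ActsTransitively ρ (H.Uν ν)) :
    ∃ F : S.AlexanderModule ρ r h →ₗ[ℤ[T;T⁻¹]] ℤ[T;T⁻¹], F ≠ 0 := by
  obtain ⟨g, hg, i₀, j₀, hij⟩ := exists_invariant_of_not_actsTransitively ρ hν ℤ[T;T⁻¹]
  let L : G →* AddMonoid.End (ℤ → Fin N → ℤ[T;T⁻¹]) := inducedAction ρ
  let t : ℤ → Fin N → ℤ[T;T⁻¹] := fun m i => weight r ν m * g i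
  have ht : ∀ a : H.U, L (H.φ a : H.B) (t - L S.x t) = t - L S.x t := by
    intro a
    have hd : ∀ m i, (t - L S.x t) m i = (weight r ν m - weight r ν (m + 1)) * g i := by
      intro m i
      rw [sub_mul]
      exact congrArg (fun z => weight r ν m * g i - z) (inducedAction_x ρ t m i)
    funext m i
    let v : S.K := ⟨(H.φ a : H.B), H.B_le (H.φ a : H.B).2⟩
    rw [show L (H.φ a : H.B) (t - L S.x t) m i =
      (t - L S.x t) m (RightPerm.act i (ρ ((S.μ ^ m) v))) from inducedAction_coe ρ v _ m i, hd, hd]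
    -- If `m + 1 = ν + rk`, then `μ^m v` acts like `μ^ν a'`, an element of `U_ν`; on every other
    -- level the difference of weights is zero.
    by_cases hdvd : (r : ℤ) ∣ m + 1 - ν
    · obtain ⟨k, hk⟩ := hdvd
      let a' : S.K := ⟨(a : H.B), H.B_le (a : H.B).2⟩
      have hv : v = S.μ a' := by
        ext
        have := H.conj_eq a
        rw [μ, MulAut.conjNormal_apply]
        exact eq_mul_inv_of_mul_eq this.symm
      have hm : S.μ ^ m * S.μ = S.μ ^ ((r : ℤ) * k) * S.μ ^ ν := by
        rw [← zpow_add_one, ← zpow_add, ← hk]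
        congr 1
        ring
      rw [hv, ← MulAut.mul_apply, hm, MulAut.mul_apply, h.map_zpow_eq, hg]
      rw [HNNDecomposition.Uν, Subgroup.mem_subgroupOf]
      refine ⟨(a : H.B), ⟨a, a.2, rfl⟩, ?_⟩
      rw [coe_μ_zpow, zpow_neg]
      rfl
    · rw [weight_succ h.1 hdvd, sub_self, zero_mul, zero_mul]
  obtain ⟨c, hmul, hB, hx⟩ := H.exists_crossedHom L t ht
  have hone : c 1 = 0 := by
    have := hmul 1 1
    rw [mul_one, AddMonoid.End.map_one_apply] at this
    exact left_eq_add.1 this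
  have hinv : ∀ a, c a⁻¹ = - L a⁻¹ (c a) := by
    intro a
    have := hmul a⁻¹ a
    rw [inv_mul_cancel, hone] at this
    exact eq_neg_of_add_eq_zero_left this.symm
  -- The function `t` scales by `s` under `m ↦ m + r`, and the action preserves this property, so
  -- every value of `c` inherits it.
  have hper : ∀ a m i, c a (m + r) i = LaurentPolynomial.T 1 * c a m i := by
    have hL : ∀ (a : G) (F : ℤ → Fin N → ℤ[T;T⁻¹]),
        (∀ m i, F (m + r) i = LaurentPolynomial.T 1 * F m i) →
        ∀ m i, L a F (m + r) i = LaurentPolynomial.T 1 * L a F m i := by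
      intro a F hF m i
      change F (m + r + S.deg a) (RightPerm.act i (ρ (S.twist (m + r) a))) =
        LaurentPolynomial.T 1 * F (m + S.deg a) (RightPerm.act i (ρ (S.twist m a)))
      rw [twist_add, zpow_natCast, h.map_eq, add_right_comm, hF]
    have hpt : ∀ m i, t (m + r) i = LaurentPolynomial.T 1 * t m i := by
      intro m i
      change weight r ν (m + r) * g i = LaurentPolynomial.T 1 * (weight r ν m * g i)
      rw [weight_add h.1, mul_assoc]
    intro a
    refine H.induction_on
      (p := fun a => ∀ m i, c a (m + r) i = LaurentPolynomial.T 1 * c a m i) a ?_ ?_ ?_ ?_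
    · intro b hb m i
      rw [hB b hb, Pi.sub_apply, Pi.sub_apply, Pi.sub_apply, Pi.sub_apply, hpt, hL b t hpt, mul_sub]
    · intro m i
      rw [hx]
      simp
    · intro a b ha hb m i
      rw [hmul, Pi.add_apply, Pi.add_apply, Pi.add_apply, Pi.add_apply, ha, hL a _ hb, mul_add]
    · intro a ha m i
      rw [hinv, Pi.neg_apply, Pi.neg_apply, Pi.neg_apply, Pi.neg_apply, hL _ _ ha, mul_neg]
  have hxpow : ∀ k : ℤ, c (S.x ^ k) = 0 := by
    intro k
    induction k using Int.induction_on with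
    | zero => rw [zpow_zero, hone]
    | succ n ih => rw [zpow_add_one, hmul, ih, hx, map_zero, add_zero]
    | pred n ih => rw [zpow_sub_one, hmul, ih, hinv, hx, map_zero, neg_zero, map_zero, add_zero]
  -- As `c` vanishes on powers of `x`, conjugating by `x^k` only moves level `0` to level `k`. For
  -- `k = r` this and `hper` give the equivariance of the form; general `k` serves to show that the
  -- form is nonzero.
  have hconj : ∀ (k : ℤ) (u : S.K) (i : Fin N), c ((S.μ ^ k) u : S.K) 0 i = c u k i := by
    intro k u i
    rw [coe_μ_zpow, hmul, hmul, hxpow, hxpow, map_zero, add_zero, zero_add]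
    change c u (0 + S.deg (S.x ^ k)) (RightPerm.act i (ρ (S.twist 0 (S.x ^ k)))) = c u k i
    have h1 : S.twist 0 (S.x ^ k) = 1 := by
      ext
      simp [twist, deg_x_zpow]
    rw [h1, map_one, deg_x_zpow, zero_add]
    rfl
  obtain ⟨F, hF⟩ := AlexanderModule.exists_linearMap h (fun i u => c u 0 i)
    (fun i u v => by
      have h1 := inducedAction_coe ρ u (c v) 0 i
      rw [zpow_zero, MulAut.one_apply] at h1
      change c ((u : G) * v) 0 i = c u 0 i + c v 0 (RightPerm.act i (ρ u))
      rw [hmul, Pi.add_apply, Pi.add_apply, ← h1])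
    (fun i u => by
      have h1 := hconj r u i
      rw [zpow_natCast] at h1
      rw [h1, ← hper, zero_add])
  refine ⟨F, fun hF0 => ?_⟩
  have hc : ∀ (u : S.K) i, c u 0 i = 0 := fun u i => by rw [← hF, hF0]; rfl
  let J : Subgroup S.K :=
    { carrier := {u | ∀ i, g (RightPerm.act i (ρ u)) = g i}
      one_mem' := fun i => by rw [map_one]; rfl
      mul_mem' := fun {u v} hu hv i => by rw [map_mul, RightPerm.act_mul, hv, hu]
      inv_mem' := fun {u} hu i => by
        rw [← hu, ← RightPerm.act_mul, ← map_mul, inv_mul_cancel, map_one]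
        rfl }
  have hJ : ∀ u, u ∈ J := by
    refine H.mem_of_conj_mem fun m b hb i => ?_
    -- Vanishing at level `0` on `μ^m b` is vanishing of `t - b·t` at level `m`, where the nonzero
    -- weight cancels.
    have h1 := hc ((S.μ ^ m) b) i
    rw [hconj, hB b hb, Pi.sub_apply, Pi.sub_apply,
      show L b t m i = weight r ν m * g (RightPerm.act i (ρ ((S.μ ^ m) b))) from
        inducedAction_coe ρ b t m i] at h1
    exact (mul_left_cancel₀ (weight_ne_zero r ν m) (sub_eq_zero.1 h1)).symm
  obtain ⟨u, -, hu⟩ := hK i₀ j₀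
  exact hij (by rw [← hu, hJ u i₀])

end AugmentedGroupSystem

theorem mainTheorem8 {G : Type*} [Group G] (S : AugmentedGroupSystem G)
    {N : ℕ} (ρ : S.K →* RightPerm N) (hK : ActsTransitively ρ ⊤)
    {r : ℕ} (hr : S.HasPeriod ρ r)
    (H : S.HNNDecomposition)
    (hU : ∃ ν : ℤ, 1 ≤ ν ∧ ν ≤ (r : ℤ) - 1 ∧ ¬ ActsTransitively ρ (H.Uν ν)) :
    ∀ D : LaurentPolynomial ℤ, S.IsAlexanderLinPolynomial ρ r hr D ↔ D = 0 := by
  obtain ⟨ν, -, -, hν⟩ := hU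
  obtain ⟨F, hF⟩ := H.exists_linearMap_ne_zero hK hr hν
  have := AugmentedGroupSystem.AlexanderModule.finite hr H
  have := LaurentPolynomial.isNoetherianRing_int
  exact isModuleOrder_iff_eq_zero F hF
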